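/- All graphs are finite and simple. A branch decomposition of a graph $G=(V,E)$ is a rooted binary tree $T$ (every internal node has exactly two children) whose leaves are in bijection with $V$. For a node $t$ of $T$ let $A_t\subseteq V$ be the set of leaves in the subtree of $T$ rooted at $t$, and let $G[A_t,V\setminus A_t]$ be the bipartite graph on $V$ consisting of all edges of $G$ with one end in $A_t$ and the other in $V\setminus A_t$. The mim-width of $T$ is the maximum, over all nodes $t$, of the size of a maximum induced matching in $G[A_t,V\setminus A_t]$, and the mim-width $\mathsf{mimw}(G)$ is the minimum mim-width of a branch decomposition of $G$. A graph is a comparability graph if its edges can be directed so that whenever $ab$ and $bc$ are directed edges, so is $ac$; a co-comparability graph is the complement of a comparability graph. **Theorem.** There is a family $\mathcal G_{cc}$ of co-comparability graphs, infinite up to isomorphism, and a constant $c>0$ such that $\mathsf{mimw}(G)\ge c\,|V(G)|$ for every $G\in\mathcal G_{cc}$. Moreover, every $G\in\mathcal G_{cc}$ has a bipartite complement and arises from a bipartite graph $H$ on the same vertex set, with colour classes $X$ and $Y$ and $\mathsf{mimw}(H)\ge c\,|V(H)|$, by adding all edges between distinct vertices of the same colour class. -/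

import Mathlib

/-- Rooted binary trees with leaves labelled by elements of `V`: every node is either a leaf or an
internal node with exactly two children. -/
inductive BranchTree (V : Type*) where
  | leaf (v : V) : BranchTree V
  | node (left right : BranchTree V) : BranchTree V

namespace BranchTree

/-- The list of leaf labels of a tree. -/
def leaves {V : Type*} : BranchTree V → List V
  | leaf v => [v]
  | node l r => l.leaves ++ r.leaves

/-- The list of the subtrees `T_t` of `T`, one for each node `t` of `T` (the root included). -/
def subtrees {V : Type*} : BranchTree V → List (BranchTree V)
  | leaf v => [leaf v]
  | node l r => node l r :: (l.subtrees ++ r.subtrees)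

/-- `T` is a branch decomposition (of any graph on `V`) if its leaves are exactly the elements of
`V`, each occurring once. -/
structure IsBranchDecomposition {V : Type*} (T : BranchTree V) : Prop where
  nodup : T.leaves.Nodup
  mem_leaves : ∀ v : V, v ∈ T.leaves

end BranchTree

namespace SimpleGraph

/-- The mim-value of the partition `A, Aᶜ`: the maximum number of edges of an induced matching in
the bipartite graph `G[A, Aᶜ]`. The set below contains `0` and, for finite `V`, is bounded. -/
noncomputable def mimValue {V : Type*} (G : SimpleGraph V) (A : Set V) : ℕ :=
  sSup {k | ∃ M : (G.between A Aᶜ).Subgraph,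
    M.IsMatching ∧ M.IsInduced ∧ M.edgeSet.ncard = k}

/-- The mim-width of a tree: the maximum, over its nodes `t`, of the mim-value of the partition
whose first part is the set of leaves below `t`. -/
noncomputable def treeMimWidth {V : Type*} (G : SimpleGraph V) (T : BranchTree V) : ℕ :=
  sSup {k | ∃ S ∈ T.subtrees, G.mimValue {v | v ∈ S.leaves} = k}

/-- The mim-width of a graph: the minimum mim-width of its branch decompositions.
(For finite nonempty `V` there is a branch decomposition; for empty `V` the value is `0`.) -/
noncomputable def mimWidth {V : Type*} (G : SimpleGraph V) : ℕ :=
  sInf {k | ∃ T : BranchTree V, T.IsBranchDecomposition ∧ G.treeMimWidth T = k}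

/-- A comparability graph: the edges can be directed (each in exactly one direction) so that
the directed edges form a transitive relation. -/
def IsComparabilityGraph {V : Type*} (G : SimpleGraph V) : Prop :=
  ∃ r : V → V → Prop, (∀ a b, G.Adj a b ↔ r a b ∨ r b a) ∧
    (∀ a b, r a b → ¬ r b a) ∧ (∀ a b c, r a b → r b c → r a c)

/-- A co-comparability graph: the complement is a comparability graph. -/
def IsCoComparabilityGraph {V : Type*} (G : SimpleGraph V) : Prop :=
  Gᶜ.IsComparabilityGraph

/-- The graph obtained from `H` by adding all edges between distinct vertices that lie both in `X`
or both outside `X`. -/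
def makeCliques {V : Type*} (H : SimpleGraph V) (X : Set V) : SimpleGraph V :=
  H ⊔ SimpleGraph.fromRel (fun v w => (v ∈ X ∧ w ∈ X) ∨ (v ∉ X ∧ w ∉ X))

end SimpleGraph

/-! Join two copies of an `8 k`-set by the edges `x ~ σ i x` of 40 permutations. By counting
(`exists_expanding_perms`), some choice traps no `k` points inside `6 k` images. Every branch
decomposition has a balanced cut (`exists_balanced_subtree`). Expansion gives at least `k` left
vertices on one side with a neighbour across the cut, and bounded degree lets a constant fraction of
these edges be chosen as an induced matching (`exists_induced_matching_of_perms`).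

All left ends lie on one side and all right ends on the other, so edges inside the colour classes
never cross between chosen ends. Hence turning the classes into cliques keeps the bound, while the
complement becomes bipartite. -/

/-! ### Expanding permutations by counting -/

open Finset in
/-- Double counting the permutations that map `R` and one more point into `T`. -/
theorem card_perm_mapsTo_insert {ι : Type*} [Fintype ι] [DecidableEq ι] (R T : Finset ι) {a : ι}
    (ha : a ∉ R) :
    (Fintype.card ι - #R) * #{σ : Equiv.Perm ι | ∀ x ∈ insert a R, σ x ∈ T} =
      (#T - #R) * #{σ : Equiv.Perm ι | ∀ x ∈ R, σ x ∈ T} := by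
  -- Composing with the transposition of `a` and `b` makes the count independent of the added point.
  have hswap : ∀ b ∈ Rᶜ, #{σ : Equiv.Perm ι | ∀ x ∈ insert b R, σ x ∈ T} =
      #{σ : Equiv.Perm ι | ∀ x ∈ insert a R, σ x ∈ T} := by
    intro b hb
    rw [mem_compl] at hb
    have key : ∀ x ∈ R, Equiv.swap a b x = x := fun x hx =>
      Equiv.swap_apply_of_ne_of_ne (fun h => ha (h ▸ hx)) (fun h => hb (h ▸ hx))
    refine card_equiv (Equiv.mulRight (Equiv.swap a b)) fun σ => ?_
    simp only [mem_filter, mem_univ, true_and, forall_mem_insert, Equiv.coe_mulRight,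
      Equiv.Perm.mul_apply, Equiv.swap_apply_left]
    refine and_congr_right fun _ => forall₂_congr fun x hx => ?_
    rw [key x hx]
  have hfib : ∀ σ ∈ ({σ : Equiv.Perm ι | ∀ x ∈ R, σ x ∈ T} : Finset _),
      #(bipartiteBelow (fun b (σ : Equiv.Perm ι) => σ b ∈ T) Rᶜ σ) = #T - #R := by
    intro σ hσ
    rw [mem_filter] at hσ
    have h1 : bipartiteBelow (fun b (σ : Equiv.Perm ι) => σ b ∈ T) Rᶜ σ =
        T.map σ.symm.toEmbedding \ R := by
      ext b
      simp [bipartiteBelow, mem_map_equiv, and_comm]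
    rw [h1, card_sdiff_of_subset, card_map]
    intro x hx
    simpa [mem_map_equiv] using hσ.2 x hx
  have hcount := sum_card_bipartiteAbove_eq_sum_card_bipartiteBelow
    (s := Rᶜ) (t := ({σ : Equiv.Perm ι | ∀ x ∈ R, σ x ∈ T} : Finset _))
    (fun b σ => σ b ∈ T)
  have habove : ∀ b ∈ Rᶜ, #(bipartiteAbove (fun b (σ : Equiv.Perm ι) => σ b ∈ T)
      ({σ : Equiv.Perm ι | ∀ x ∈ R, σ x ∈ T} : Finset _) b) =
        #{σ : Equiv.Perm ι | ∀ x ∈ insert a R, σ x ∈ T} := by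
    intro b hb
    rw [← hswap b hb, bipartiteAbove, filter_filter]
    congr 1
    ext σ
    simp [and_comm]
  rw [sum_congr rfl habove, sum_congr rfl hfib, sum_const, sum_const,
    card_compl] at hcount
  simpa [mul_comm] using hcount

-- Each further point of `R` lands in `T` with conditional probability `(#T - #R) / (n - #R) ≤ 3/4`,
-- where `n` is the number of points.
open Finset in
theorem four_pow_mul_card_perm_mapsTo_le {ι : Type*} [Fintype ι] [DecidableEq ι] (R T : Finset ι)
    (hT : 4 * #T ≤ 3 * Fintype.card ι) :
    4 ^ #R * #{σ : Equiv.Perm ι | ∀ x ∈ R, σ x ∈ T} ≤ 3 ^ #R * (Fintype.card ι).factorial := by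
  induction R using Finset.induction_on with
  | empty => simp [Fintype.card_perm]
  | insert a R ha ih =>
    have h := card_perm_mapsTo_insert R T ha
    have hpos : 0 < Fintype.card ι - #R := by
      have := card_le_univ (insert a R)
      rw [card_insert_of_notMem ha] at this
      omega
    set N := #{σ : Equiv.Perm ι | ∀ x ∈ R, σ x ∈ T}
    set N' := #{σ : Equiv.Perm ι | ∀ x ∈ insert a R, σ x ∈ T}
    have hstep : 4 * N' ≤ 3 * N := by
      refine Nat.le_of_mul_le_mul_left ?_ hpos
      calc (Fintype.card ι - #R) * (4 * N') = 4 * (#T - #R) * N := by linarith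
        _ ≤ (3 * (Fintype.card ι - #R)) * N := Nat.mul_le_mul_right _ (by omega)
        _ = _ := by ring
    rw [card_insert_of_notMem ha]
    calc 4 ^ (#R + 1) * N' = 4 ^ #R * (4 * N') := by ring
      _ ≤ 4 ^ #R * (3 * N) := by gcongr
      _ = 3 * (4 ^ #R * N) := by ring
      _ ≤ 3 * (3 ^ #R * (Fintype.card ι).factorial) := by gcongr
      _ = _ := by ring

open Finset in
/-- On `8 k` points there are `40` permutations such that no set of `k` points is mapped by all of
them into a common set of at most `6 k` points. -/
theorem exists_expanding_perms {ι : Type*} [Fintype ι] [DecidableEq ι] {k : ℕ} (hk : 0 < k)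
    (hι : Fintype.card ι = 8 * k) :
    ∃ σ : Fin 40 → Equiv.Perm ι, ∀ R T : Finset ι, k ≤ #R → #T ≤ 6 * k →
      ∃ x ∈ R, ∃ i, σ i x ∉ T := by
  let P : Finset (Finset ι × Finset ι) := {p | #p.1 = k ∧ #p.2 ≤ 6 * k}
  let bad : Finset ι × Finset ι → Finset (Fin 40 → Equiv.Perm ι) := fun p =>
    Fintype.piFinset fun _ => {σ : Equiv.Perm ι | ∀ x ∈ p.1, σ x ∈ p.2}
  have hbad : ∀ p ∈ P, 4 ^ (40 * k) * #(bad p) ≤ 3 ^ (40 * k) * (8 * k).factorial ^ 40 := by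
    intro p hp
    obtain ⟨h1, h2⟩ : #p.1 = k ∧ #p.2 ≤ 6 * k := by simpa [P] using hp
    have h := four_pow_mul_card_perm_mapsTo_le p.1 p.2 (by omega)
    rw [h1, hι] at h
    have := Nat.pow_le_pow_left h 40
    simp only [bad, Fintype.card_piFinset_const]
    rwa [mul_pow, mul_pow, ← pow_mul, ← pow_mul, mul_comm k] at this
  have hP : #P ≤ 4 ^ (8 * k) := by
    refine (card_le_univ P).trans ?_
    rw [Fintype.card_prod, Fintype.card_finset, hι, ← mul_pow]
    norm_num
  have hlt : #(P.biUnion bad) < Fintype.card (Fin 40 → Equiv.Perm ι) := by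
    have hcard : Fintype.card (Fin 40 → Equiv.Perm ι) = (8 * k).factorial ^ 40 := by
      simp [Fintype.card_perm, hι]
    rw [hcard]
    refine Nat.lt_of_mul_lt_mul_left (a := 4 ^ (40 * k)) ?_
    calc 4 ^ (40 * k) * #(P.biUnion bad) ≤ 4 ^ (40 * k) * ∑ p ∈ P, #(bad p) := by
          gcongr; exact card_biUnion_le
      _ = ∑ p ∈ P, 4 ^ (40 * k) * #(bad p) := mul_sum ..
      _ ≤ #P • (3 ^ (40 * k) * (8 * k).factorial ^ 40) := sum_le_card_nsmul _ _ _ hbad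
      _ ≤ 4 ^ (8 * k) * (3 ^ (40 * k) * (8 * k).factorial ^ 40) := by
          rw [smul_eq_mul]; gcongr
      -- Union bound over at most `4 ^ (8 * k)` pairs; 40 permutations suffice because `4 ^ 8 * 3 ^
      -- 40 < 4 ^ 40`.
      _ = (4 ^ 8 * 3 ^ 40) ^ k * (8 * k).factorial ^ 40 := by
          rw [mul_pow, ← pow_mul, ← pow_mul, mul_assoc]
      _ < (4 ^ 40) ^ k * (8 * k).factorial ^ 40 := by
          refine Nat.mul_lt_mul_of_pos_right ?_ (pow_pos (Nat.factorial_pos _) _)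
          exact Nat.pow_lt_pow_left (by norm_num) hk.ne'
      _ = 4 ^ (40 * k) * (8 * k).factorial ^ 40 := by rw [← pow_mul]
  obtain ⟨σ, -, hσ⟩ : ∃ σ ∈ (univ : Finset (Fin 40 → Equiv.Perm ι)), σ ∉ P.biUnion bad :=
    exists_mem_notMem_of_card_lt_card (by rwa [card_univ])
  refine ⟨σ, fun R T hR hT => ?_⟩
  obtain ⟨R', hR', hcard⟩ := exists_subset_card_eq hR
  by_contra! hcon
  refine hσ (mem_biUnion.2 ⟨(R', T), by simp [P, hcard, hT], ?_⟩)
  simp only [bad, Fintype.mem_piFinset, mem_filter, mem_univ, true_and]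
  exact fun i x hx => hcon x (hR' hx) i

/-! ### Balanced subtrees -/

namespace BranchTree

theorem leaves_sublist_of_mem_subtrees {V : Type*} {S T : BranchTree V} (h : S ∈ T.subtrees) :
    S.leaves.Sublist T.leaves := by
  induction T with
  | leaf v =>
    rw [subtrees, List.mem_singleton] at h
    rw [h]
  | node l r ihl ihr =>
    rw [subtrees, List.mem_cons, List.mem_append] at h
    rcases h with rfl | h | h
    · exact List.Sublist.refl _
    · exact (ihl h).trans (List.sublist_append_left _ _)
    · exact (ihr h).trans (List.sublist_append_right _ _)

/-- A tree with more than `2 N / 3` leaves has a subtree with between `N / 3` and `2 N / 3`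
leaves. -/
theorem exists_balanced_subtree {V : Type*} (T : BranchTree V) {N : ℕ} (hN : 2 ≤ N)
    (hT : 2 * N < 3 * T.leaves.length) :
    ∃ S ∈ T.subtrees, N ≤ 3 * S.leaves.length ∧ 3 * S.leaves.length ≤ 2 * N := by
  have self_mem : ∀ U : BranchTree V, U ∈ U.subtrees := by
    rintro (_ | _) <;> simp [subtrees]
  induction T with
  | leaf v =>
    simp only [leaves, List.length_singleton] at hT
    omega
  | node l r ihl ihr =>
    -- Descend into a child that is still too large; if there is none, the larger child has more
    -- than `N / 3` leaves.
    by_cases hl : 2 * N < 3 * l.leaves.length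
    · obtain ⟨S, hS, h⟩ := ihl hl
      exact ⟨S, by simp [subtrees, hS], h⟩
    by_cases hr : 2 * N < 3 * r.leaves.length
    · obtain ⟨S, hS, h⟩ := ihr hr
      exact ⟨S, by simp [subtrees, hS], h⟩
    simp only [leaves, List.length_append] at hT
    rcases le_total l.leaves.length r.leaves.length with h | h
    · exact ⟨r, by simp [subtrees, self_mem r], by omega, by omega⟩
    · exact ⟨l, by simp [subtrees, self_mem l], by omega, by omega⟩

theorem exists_leaves_eq {V : Type*} (l : List V) (hl : l ≠ []) :
    ∃ T : BranchTree V, T.leaves = l := by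
  induction l with
  | nil => exact absurd rfl hl
  | cons v l ih =>
    rcases eq_or_ne l [] with rfl | h
    · exact ⟨leaf v, rfl⟩
    · obtain ⟨T, rfl⟩ := ih h
      exact ⟨node (leaf v) T, rfl⟩

theorem exists_isBranchDecomposition (V : Type*) [Finite V] [Nonempty V] :
    ∃ T : BranchTree V, T.IsBranchDecomposition := by
  have := Fintype.ofFinite V
  obtain ⟨T, hT⟩ := exists_leaves_eq (Finset.univ : Finset V).toList
    (by simpa using Finset.univ_nonempty.ne_empty)
  exact ⟨T, hT ▸ Finset.nodup_toList _, fun v => by simp [hT]⟩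

end BranchTree

/-! ### Lower bounds for mim-width -/

namespace SimpleGraph

theorem mimValue_compl {V : Type*} (G : SimpleGraph V) (A : Set V) :
    G.mimValue Aᶜ = G.mimValue A := by
  rw [mimValue, mimValue, compl_compl, between_comm]

/-- Pairs of vertices `a x ∈ A`, `b x ∉ A` whose only adjacencies are `a x ~ b x` bound the
mim-value of `A` from below. -/
theorem card_le_mimValue {V ι : Type*} [Finite V] (G : SimpleGraph V) {A : Set V} (I : Finset ι)
    (a b : ι → V) (ha : ∀ x ∈ I, a x ∈ A) (hb : ∀ x ∈ I, b x ∉ A)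
    (hadj : ∀ x ∈ I, ∀ y ∈ I, G.Adj (a x) (b y) ↔ x = y) : I.card ≤ G.mimValue A := by
  let M : (G.between A Aᶜ).Subgraph := (⊤ : Subgraph _).induce (a '' I ∪ b '' I)
  have hab : ∀ x ∈ I, M.Adj (a x) (b x) := fun x hx =>
    ⟨.inl ⟨x, hx, rfl⟩, .inr ⟨x, hx, rfl⟩, (hadj x hx x hx).2 rfl, .inl ⟨ha x hx, hb x hx⟩⟩
  have hinj : Set.InjOn a I := fun x hx y hy h =>
    (hadj x hx y hy).1 (h ▸ (hadj y hy y hy).2 rfl)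
  have hM : M.IsMatching := by
    rintro v (⟨x, hx, rfl⟩ | ⟨x, hx, rfl⟩)
    · refine ⟨b x, hab x hx, ?_⟩
      rintro w ⟨-, ⟨y, hy, rfl⟩ | ⟨y, hy, rfl⟩, hG, hA⟩
      · have := ha x hx
        have := ha y hy
        simp_all
      · rw [(hadj x hx y hy).1 hG]
    · refine ⟨a x, (hab x hx).symm, ?_⟩
      rintro w ⟨-, ⟨y, hy, rfl⟩ | ⟨y, hy, rfl⟩, hG, hA⟩
      · rw [(hadj y hy x hx).1 hG.symm]
      · have := hb x hx
        have := hb y hy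
        simp_all
  have hMi : M.IsInduced := fun v hv w hw h => ⟨hv, hw, h⟩
  have hcard : I.card ≤ M.edgeSet.ncard := by
    rw [← Set.ncard_coe_finset]
    refine Set.ncard_le_ncard_of_injOn (fun x => s(a x, b x)) (fun x hx => hab x hx) ?_
      (Set.toFinite _)
    intro x hx y hy h
    rcases Sym2.eq_iff.1 h with ⟨h, -⟩ | ⟨h, -⟩
    · exact hinj hx hy h
    · exact absurd (h ▸ ha x hx) (hb y hy)
  refine hcard.trans (le_csSup ⟨Nat.card (Sym2 V), ?_⟩ ⟨M, hM, hMi, rfl⟩)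
  rintro k ⟨M', -, -, rfl⟩
  exact Set.ncard_le_card _

theorem le_mimWidth {V : Type*} [Finite V] [Nonempty V] (G : SimpleGraph V) {k : ℕ}
    (h : ∀ T : BranchTree V, T.IsBranchDecomposition →
      ∃ S ∈ T.subtrees, k ≤ G.mimValue {v | v ∈ S.leaves}) : k ≤ G.mimWidth := by
  -- A decomposition must exist, since `sInf ∅ = 0`.
  obtain ⟨T₀, hT₀⟩ := BranchTree.exists_isBranchDecomposition V
  refine le_csInf ⟨_, T₀, hT₀, rfl⟩ ?_
  rintro _ ⟨T, hT, rfl⟩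
  obtain ⟨S, hS, hk⟩ := h T hT
  refine hk.trans (le_csSup (Set.Finite.bddAbove ?_) ⟨S, hS, rfl⟩)
  exact (List.finite_toSet T.subtrees).image fun S => G.mimValue {v | v ∈ S.leaves}

end SimpleGraph

/-! ### From expansion to induced matchings -/

open Finset in
/-- A symmetric reflexive relation with neighbourhoods of size at most `D` has an independent set
containing at least a `1 / D` fraction of the points. -/
theorem exists_independent_card_le_mul {ι : Type*} [DecidableEq ι] (B : Finset ι)
    (r : ι → ι → Prop) [DecidableRel r] (hrefl : ∀ x, r x x) (hsymm : ∀ x y, r x y → r y x)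
    {D : ℕ} (hD : ∀ x ∈ B, #{y ∈ B | r x y} ≤ D) :
    ∃ I ⊆ B, (∀ x ∈ I, ∀ y ∈ I, r x y → x = y) ∧ #B ≤ #I * D := by
  -- The neighbourhoods of a maximal independent set cover `B`.
  obtain ⟨I, hI⟩ := (B.powerset.filter fun I => ∀ x ∈ I, ∀ y ∈ I, r x y → x = y).exists_maximal
    ⟨∅, by simp⟩
  have hIm := hI.prop
  rw [mem_filter, mem_powerset] at hIm
  refine ⟨I, hIm.1, hIm.2, ?_⟩
  have hcover : B ⊆ I.biUnion fun x => {y ∈ B | r x y} := by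
    intro y hy
    rw [mem_biUnion]
    by_contra! hcon
    have hno : ∀ x ∈ I, ¬ r x y := fun x hx h => hcon x hx (mem_filter.2 ⟨hy, h⟩)
    have hins : insert y I ⊆ I := hI.le_of_ge (y := insert y I) (by
      rw [mem_filter, mem_powerset]
      refine ⟨insert_subset hy hIm.1, ?_⟩
      simp only [mem_insert]
      rintro u (rfl | hu) v (rfl | hv) huv
      · rfl
      · exact absurd (hsymm _ _ huv) (hno v hv)
      · exact absurd huv (hno u hu)
      · exact hIm.2 u hu v hv huv) (subset_insert _ _)
    exact hno y (hins (mem_insert_self _ _)) (hrefl y)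
  calc #B ≤ _ := card_le_card hcover
    _ ≤ #I * D := card_biUnion_le_card_mul _ _ _ fun x hx => hD x (hIm.1 hx)

open Finset in
/-- Among the points of `S` that some `σ i` maps out of `T`, many can be matched to such images
without further adjacencies. -/
theorem exists_induced_matching_of_perms {ι : Type*} [Fintype ι] [DecidableEq ι] {k d : ℕ}
    (σ : Fin d → Equiv.Perm ι)
    (hσ : ∀ R T : Finset ι, k ≤ #R → #T ≤ 6 * k → ∃ x ∈ R, ∃ i, σ i x ∉ T)
    (S T : Finset ι) (hS : 2 * k ≤ #S) (hT : #T ≤ 6 * k) :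
    ∃ (I : Finset ι) (f : ι → ι), I ⊆ S ∧ (∀ x ∈ I, f x ∉ T) ∧
      (∀ x ∈ I, ∀ y ∈ I, (∃ i, σ i x = f y) ↔ x = y) ∧ k ≤ #I * (d + d * d) := by
  classical
  let B : Finset ι := {x ∈ S | ∃ i, σ i x ∉ T}
  have hB : k ≤ #B := by
    by_contra! hlt
    have hsd : #(S \ B) = #S - #B := card_sdiff_of_subset (filter_subset _ _)
    obtain ⟨x, hx, hi⟩ := hσ (S \ B) T (by omega) hT
    rw [mem_sdiff] at hx
    exact hx.2 (mem_filter.2 ⟨hx.1, hi⟩)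
  have hchoice : ∀ x, ∃ y, x ∈ B → (∃ i, σ i x = y) ∧ y ∉ T := by
    intro x
    by_cases hx : x ∈ B
    · obtain ⟨i, hi⟩ := (mem_filter.1 hx).2
      exact ⟨σ i x, fun _ => ⟨⟨i, rfl⟩, hi⟩⟩
    · exact ⟨x, fun h => absurd h hx⟩
  choose f hf using hchoice
  let r : ι → ι → Prop := fun x y => x = y ∨ (∃ i, σ i x = f y) ∨ ∃ i, σ i y = f x
  obtain ⟨I, hIB, hI, hcard⟩ := exists_independent_card_le_mul B r (fun x => .inl rfl)
    (fun x y h => by simp only [r] at h ⊢; tauto) (D := d + d * d) (by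
      intro x hx
      -- Conflicts with `x`: at most `d` points have an edge to `f x`, and at most `d * d` points
      -- `y` have `f y` adjacent to `x`.
      have hsub : ({y ∈ B | r x y} : Finset ι) ⊆
          univ.image (fun i => (σ i).symm (f x)) ∪
            univ.image (fun p : Fin d × Fin d => (σ p.2).symm (σ p.1 x)) := by
        intro y hy
        obtain ⟨hyB, hxy⟩ := mem_filter.1 hy
        simp only [mem_union, mem_image, mem_univ, true_and, Prod.exists]
        rcases hxy with rfl | ⟨i, hi⟩ | ⟨i, hi⟩
        · obtain ⟨i, hi⟩ := (hf x hx).1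
          exact .inl ⟨i, by rw [← hi, Equiv.symm_apply_apply]⟩
        · obtain ⟨j, hj⟩ := (hf y hyB).1
          exact .inr ⟨i, j, by rw [hi, ← hj, Equiv.symm_apply_apply]⟩
        · exact .inl ⟨i, by rw [← hi, Equiv.symm_apply_apply]⟩
      refine (card_le_card hsub).trans ((card_union_le _ _).trans (add_le_add ?_ ?_))
      · exact card_image_le.trans (by simp)
      · exact card_image_le.trans (by simp))
  refine ⟨I, f, hIB.trans (filter_subset _ _), fun x hx => (hf x (hIB hx)).2, ?_,
    hB.trans hcard⟩
  intro x hx y hy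
  constructor
  · exact fun h => hI x hx y hy (.inr (.inl h))
  · rintro rfl
    exact (hf x (hIB hx)).1

namespace SimpleGraph

open Finset in
/-- A graph in which two sets of `8 k` vertices are joined by the edges `x ~ σ i x` of expanding
permutations has mim-width linear in `k`, whatever the edges inside the two sets. -/
theorem le_mimWidth_mul_of_perms {ι V : Type*} [Fintype ι] [DecidableEq ι] {k d : ℕ} (hk : 0 < k)
    (hι : Fintype.card ι = 8 * k) (σ : Fin d → Equiv.Perm ι)
    (hσ : ∀ R T : Finset ι, k ≤ #R → #T ≤ 6 * k → ∃ x ∈ R, ∃ i, σ i x ∉ T)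
    (e : ι ⊕ ι ≃ V) (K : SimpleGraph V)
    (hK : ∀ x y, K.Adj (e (.inl x)) (e (.inr y)) ↔ ∃ i, σ i x = y) :
    k ≤ K.mimWidth * (d + d * d) := by
  classical
  have : Fintype V := Fintype.ofEquiv _ e
  have hV : Fintype.card V = 16 * k := by
    rw [← Fintype.card_congr e, Fintype.card_sum]
    omega
  have : Nonempty V := Fintype.card_pos_iff.1 (by omega)
  have hA : ∀ A : Finset V, 16 * k ≤ 3 * #A → 3 * #A ≤ 2 * (16 * k) →
      k ≤ K.mimValue (A : Set V) * (d + d * d) := by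
    intro A h1 h2
    let S : Finset ι := {x | e (.inl x) ∈ A}
    let T : Finset ι := {y | e (.inr y) ∈ A}
    have hST : #S + #T = #A := by
      rw [← card_disjSum]
      refine card_equiv e ?_
      rintro (x | x) <;> simp [S, T]
    have hSc : #Sᶜ = 8 * k - #S := by rw [card_compl, hι]
    have hTc : #Tᶜ = 8 * k - #T := by rw [card_compl, hι]
    have hS8 : #S ≤ 8 * k := hι ▸ card_le_univ S
    -- If this fails, balance of `A` gives the same two inequalities for the complements.
    by_cases hc : 2 * k ≤ #S ∧ #T ≤ 6 * k
    · obtain ⟨I, f, hIS, hfT, hadj, hI⟩ :=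
        exists_induced_matching_of_perms σ hσ S T hc.1 hc.2
      refine hI.trans (Nat.mul_le_mul_right _ ?_)
      refine K.card_le_mimValue I (fun x => e (.inl x)) (fun x => e (.inr (f x))) ?_ ?_ ?_
      · exact fun x hx => (mem_filter.1 (hIS hx)).2
      · exact fun x hx h => hfT x hx (mem_filter.2 ⟨mem_univ _, h⟩)
      · exact fun x hx y hy => (hK _ _).trans (hadj x hx y hy)
    · obtain ⟨I, f, hIS, hfT, hadj, hI⟩ :=
        exists_induced_matching_of_perms σ hσ Sᶜ Tᶜ (by omega) (by omega)
      rw [← mimValue_compl]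
      refine hI.trans (Nat.mul_le_mul_right _ ?_)
      refine K.card_le_mimValue I (fun x => e (.inl x)) (fun x => e (.inr (f x))) ?_ ?_ ?_
      · exact fun x hx h => (mem_compl.1 (hIS hx)) (mem_filter.2 ⟨mem_univ _, h⟩)
      · intro x hx h
        have := hfT x hx
        simp only [T, mem_compl, mem_filter, mem_univ, true_and, not_not] at this
        exact h this
      · exact fun x hx y hy => (hK _ _).trans (hadj x hx y hy)
  obtain rfl | hd := Nat.eq_zero_or_pos d
  · obtain ⟨A, -, hAc⟩ := exists_subset_card_eq (s := (univ : Finset V)) (n := 8 * k)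
      (by rw [card_univ]; omega)
    simpa using hA A (by omega) (by omega)
  have hD : 0 < d + d * d := by positivity
  -- Rounding `k / D` up gives the natural-number bound that `le_mimWidth` takes.
  rw [mul_comm, ← ceilDiv_le_iff_le_mul hD]
  refine K.le_mimWidth fun T hT => ?_
  have hlen : T.leaves.length = 16 * k := by
    rw [← List.toFinset_card_of_nodup hT.nodup, ← hV, ← card_univ]
    congr 1
    ext v
    simp [hT.mem_leaves v]
  obtain ⟨S, hS, h1, h2⟩ := T.exists_balanced_subtree (N := 16 * k) (by omega) (by omega)
  refine ⟨S, hS, ?_⟩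
  have hnd := hT.nodup.sublist (BranchTree.leaves_sublist_of_mem_subtrees hS)
  have hcard := List.toFinset_card_of_nodup hnd
  rw [ceilDiv_le_iff_le_mul hD, mul_comm]
  have := hA S.leaves.toFinset (by omega) (by omega)
  rwa [List.coe_toFinset] at this

/-! ### The graphs of the family -/

/-- The bipartite graph on `e (inl x)`, `e (inr y)` with the edges given by the permutations
`σ i`. -/
def ofPerms {ι V κ : Type*} (e : ι ⊕ ι ≃ V) (σ : κ → Equiv.Perm ι) : SimpleGraph V :=
  fromRel fun v w => ∃ x i, v = e (.inl x) ∧ w = e (.inr (σ i x))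

theorem ofPerms_adj {ι V κ : Type*} (e : ι ⊕ ι ≃ V) (σ : κ → Equiv.Perm ι) (x y : ι) :
    (ofPerms e σ).Adj (e (.inl x)) (e (.inr y)) ↔ ∃ i, σ i x = y := by
  simp [ofPerms, fromRel_adj, eq_comm]

theorem ofPerms_isBipartiteWith {ι V κ : Type*} (e : ι ⊕ ι ≃ V) (σ : κ → Equiv.Perm ι) :
    (ofPerms e σ).IsBipartiteWith {v | (e.symm v).isLeft} {v | (e.symm v).isLeft}ᶜ where
  disjoint := disjoint_compl_right
  mem_of_adj v w h := by
    rcases h with ⟨-, ⟨x, i, rfl, rfl⟩ | ⟨x, i, rfl, rfl⟩⟩ <;> simp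

theorem makeCliques_adj_of_mem_of_notMem {V : Type*} (H : SimpleGraph V) {X : Set V} {v w : V}
    (hv : v ∈ X) (hw : w ∉ X) : (H.makeCliques X).Adj v w ↔ H.Adj v w := by
  simp [makeCliques, hv, hw]

theorem mem_iff_notMem_of_compl_makeCliques_adj {V : Type*} {H : SimpleGraph V} {X : Set V}
    {v w : V} (h : (H.makeCliques X)ᶜ.Adj v w) : v ∈ X ↔ w ∉ X := by
  simp only [makeCliques, compl_adj, sup_adj, fromRel_adj] at h
  tauto

theorem isCoComparabilityGraph_makeCliques {V : Type*} (H : SimpleGraph V) (X : Set V) :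
    (H.makeCliques X).IsCoComparabilityGraph := by
  -- Directing all edges out of `X` leaves no directed path of length two, so transitivity is
  -- vacuous.
  refine ⟨fun v w => (H.makeCliques X)ᶜ.Adj v w ∧ v ∈ X ∧ w ∉ X, fun v w => ⟨fun h => ?_, ?_⟩,
    ?_, ?_⟩
  · have hvw := mem_iff_notMem_of_compl_makeCliques_adj h
    by_cases hv : v ∈ X
    · exact .inl ⟨h, hv, hvw.1 hv⟩
    · exact .inr ⟨h.symm, by tauto, hv⟩
  · rintro (h | h)
    exacts [h.1, h.1.symm]
  · exact fun v w h h' => h.2.2 h'.2.1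
  · exact fun u v w h h' => absurd h'.2.1 h.2.2

theorem isBipartite_compl_makeCliques {V : Type*} (H : SimpleGraph V) (X : Set V) :
    (H.makeCliques X)ᶜ.IsBipartite := by
  refine IsBipartiteWith.isBipartite (s := X) (t := Xᶜ) ⟨disjoint_compl_right, fun v w h => ?_⟩
  have := mem_iff_notMem_of_compl_makeCliques_adj h
  simp only [Set.mem_compl_iff]
  tauto

/-- For every `k > 0` there is a bipartite graph on `16 k` vertices such that it and the graph
obtained by making its colour classes cliques have mim-width at least `k / 1640`. -/
theorem exists_isBipartiteWith_le_mimWidth {k : ℕ} (hk : 0 < k) :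
    ∃ (H : SimpleGraph (Fin (16 * k))) (X : Set (Fin (16 * k))), H.IsBipartiteWith X Xᶜ ∧
      k ≤ H.mimWidth * 1640 ∧ k ≤ (H.makeCliques X).mimWidth * 1640 := by
  obtain ⟨σ, hσ⟩ := exists_expanding_perms (ι := Fin (8 * k)) hk (by simp)
  let e : Fin (8 * k) ⊕ Fin (8 * k) ≃ Fin (16 * k) :=
    finSumFinEquiv.trans (finCongr (by omega))
  refine ⟨ofPerms e σ, _, ofPerms_isBipartiteWith e σ, ?_, ?_⟩
  · exact le_mimWidth_mul_of_perms hk (by simp) σ hσ e _ (ofPerms_adj e σ)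
  · refine le_mimWidth_mul_of_perms hk (by simp) σ hσ e _ fun x y => ?_
    rw [makeCliques_adj_of_mem_of_notMem _ (by simp) (by simp), ofPerms_adj]

end SimpleGraph

/-- A family is a set of graphs on the vertex sets `Fin n`. As there are only finitely many graphs
for each `n`, an infinite such set contains infinitely many graphs up to isomorphism. -/
theorem theorem7 :
    ∃ c : ℝ, 0 < c ∧ ∃ 𝓕 : Set (Σ n : ℕ, SimpleGraph (Fin n)), 𝓕.Infinite ∧
      ∀ (n : ℕ) (G : SimpleGraph (Fin n)), (⟨n, G⟩ : Σ n : ℕ, SimpleGraph (Fin n)) ∈ 𝓕 →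
        G.IsCoComparabilityGraph ∧
        c * (n : ℝ) ≤ (G.mimWidth : ℝ) ∧
        Gᶜ.IsBipartite ∧
        ∃ (H : SimpleGraph (Fin n)) (X : Set (Fin n)),
          H.IsBipartiteWith X Xᶜ ∧ c * (n : ℝ) ≤ (H.mimWidth : ℝ) ∧ G = H.makeCliques X := by
  choose H X hH hHw hGw using
    fun k : ℕ => SimpleGraph.exists_isBipartiteWith_le_mimWidth k.succ_pos
  have hlin : ∀ k w : ℕ, k + 1 ≤ w * 1640 →
      (1 / 26240 : ℝ) * ((16 * (k + 1) : ℕ) : ℝ) ≤ (w : ℝ) := by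
    intro k w h
    have : ((k + 1 : ℕ) : ℝ) ≤ ((w * 1640 : ℕ) : ℝ) := by exact_mod_cast h
    push_cast at this ⊢
    linarith
  -- `26240 = 16 * 1640` with `1640 = 40 + 40 * 40`; distinct vertex counts make the family
  -- infinite.
  refine ⟨1 / 26240, by norm_num,
    Set.range fun k => ⟨16 * (k + 1), (H k).makeCliques (X k)⟩, ?_, ?_⟩
  · refine Set.infinite_range_of_injective fun k l h => ?_
    have := congrArg Sigma.fst h
    simp only at this
    omega
  · rintro n G ⟨k, hkG⟩
    cases hkG
    exact ⟨SimpleGraph.isCoComparabilityGraph_makeCliques _ _, hlin k _ (hGw k),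
      SimpleGraph.isBipartite_compl_makeCliques _ _, H k, X k, hH k, hlin k _ (hHw k), rfl⟩
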